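/- Let $n\ge 1$, and let $\mathbb H^n=\mathbb C^n\times\mathbb R$ be the Heisenberg group with group law $(z,t)(w,s)=\big(z+w,\;t+s+\tfrac12\,\mathrm{Im}(z\cdot\bar w)\big)$ and Lebesgue (Haar) measure $dw\,ds$. For $k=0,1,2,\dots$ let $R_k=\{(\lambda,\tau)\in\mathbb R^2:\tau=(2k+n)|\lambda|\}$, let $R_\infty=\{(0,\tau):\tau\ge 0\}$, and let the Heisenberg fan $\Omega=R_\infty\cup\bigcup_{k\ge 0}R_k\subset\mathbb R^2$ carry the Euclidean metric. For $a\in\Omega$ define $e_a:\mathbb H^n\to\mathbb C$ as follows. If $a=(\lambda,(2k+n)|\lambda|)\in R_k$ with $\lambda\neq0$, put $$e_a(z,t)=e^{i\lambda t}\,L_k^{n-1}\!\big(\tfrac12|\lambda||z|^2\big)\,e^{-\frac14|\lambda||z|^2},$$ where $L_k^{n-1}$ is the Laguerre polynomial of type $n-1$. If $a=(0,\tau)$ with $\tau\ge0$, put $$e_a(z,t)=(n-1)!\,2^{n-1}\,\frac{J_{n-1}(\sqrt\tau\,|z|)}{(\sqrt\tau\,|z|)^{n-1}},$$ where $J_{n-1}$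 is the Bessel function of order $n-1$ and the quotient $J_{n-1}(x)/x^{n-1}$ takes its limiting value $1/(2^{n-1}(n-1)!)$ at $x=0$ (so $e_{(0,0)}\equiv1$). For $f\in L^1(\mathbb H^n)$, $a\in\Omega$ and $z\in\mathbb C^n$ define the Strichartz Fourier transform by $$\widehat f(a,z)=\int_{\mathbb H^n}f(w,s)\,e_a\big((w,s)^{-1}(z,0)\big)\,dw\,ds,$$ and the normalised Strichartz Fourier transform by $$\widetilde f(a,z)=\frac{k!\,(n-1)!}{(k+n-1)!}\,\widehat f(a,z)\quad\text{for } a=(\lambda,(2k+n)|\lambda|),\ \lambda\ne0,\qquad \widetilde f(a,z)=\widehat f(a,z)\quad\text{for } a=(0,\tau),\ \tau\ge0.$$ **Theorem.** Let $f\in L^1(\mathbb H^n)$ and fix $z\in\mathbb C^n$. Then the integral defining $\widehat f(a,z)$ converges absolutely for every $a\in\Omega$, the function $a\mapsto\widetilde f(a,z)$ is uniformly continuous on $\Omega$, and $\widetilde f(a,z)\to0$ as $|a|\to\infty$, $a\in\Omega$. -/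

import Mathlib

open MeasureTheory Filter Topology
open scoped Nat

noncomputable section

/-- The underlying manifold `ℂⁿ × ℝ` of the Heisenberg group `ℍⁿ`. -/
def Heisenberg (n : ℕ) : Type := EuclideanSpace ℂ (Fin n) × ℝ

/-- The point `(z, t)` of `ℍⁿ`. -/
def Heisenberg.mk {n : ℕ} (z : EuclideanSpace ℂ (Fin n)) (t : ℝ) : Heisenberg n := (z, t)

/-- The Haar measure `dz dt`: Lebesgue measure on `ℂⁿ × ℝ`. -/
instance Heisenberg.instMeasureSpace (n : ℕ) : MeasureSpace (Heisenberg n) :=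
  inferInstanceAs (MeasureSpace (EuclideanSpace ℂ (Fin n) × ℝ))

/-- The symplectic form `Im (z · w̄)` on `ℂⁿ`. -/
def imDot {n : ℕ} (z w : EuclideanSpace ℂ (Fin n)) : ℝ :=
  (∑ j, z j * (starRingEnd ℂ) (w j)).im

/-- The group law `(z, t)(w, s) = (z + w, t + s + ½ Im (z · w̄))`, with inverse
`(z, t)⁻¹ = (-z, -t)`. -/
instance Heisenberg.instGroup (n : ℕ) : Group (Heisenberg n) where
  mul g h := (g.1 + h.1, g.2 + h.2 + (1 / 2) * imDot g.1 h.1)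
  one := (0, 0)
  inv g := (-g.1, -g.2)
  mul_assoc g h k := by
    refine Prod.ext (add_assoc g.1 h.1 k.1) ?_
    change g.2 + h.2 + (1 / 2) * imDot g.1 h.1 + k.2 + (1 / 2) * imDot (g.1 + h.1) k.1 =
      g.2 + (h.2 + k.2 + (1 / 2) * imDot h.1 k.1) + (1 / 2) * imDot g.1 (h.1 + k.1)
    simp only [imDot, PiLp.add_apply, map_add, add_mul, mul_add, Finset.sum_add_distrib,
      Complex.add_im]
    ring
  one_mul g := by
    refine Prod.ext (zero_add g.1) ?_
    change 0 + g.2 + (1 / 2) * imDot 0 g.1 = g.2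
    simp [imDot]
  mul_one g := by
    refine Prod.ext (add_zero g.1) ?_
    change g.2 + 0 + (1 / 2) * imDot g.1 0 = g.2
    simp [imDot]
  inv_mul_cancel g := by
    refine Prod.ext (neg_add_cancel g.1) ?_
    change -g.2 + g.2 + (1 / 2) * imDot (-g.1) g.1 = 0
    simp [imDot, Complex.mul_conj]

/-- The Laguerre polynomial `L_k^δ` of type `δ ∈ ℕ`,
`L_k^δ(x) = ∑_{j ≤ k} (-1)^j binom(k + δ, k - j) x^j / j!`. -/
def laguerreL (δ k : ℕ) (x : ℝ) : ℝ :=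
  ∑ j ∈ Finset.range (k + 1), (-1) ^ j * ((k + δ).choose (k - j) : ℝ) * x ^ j / (j ! : ℝ)

/-- The Bessel function `J_ν` of the first kind of order `ν ∈ ℕ`,
`J_ν(x) = ∑_m (-1)^m / (m! (m + ν)!) (x/2)^(2m + ν)`. -/
def besselJ (ν : ℕ) (x : ℝ) : ℝ :=
  ∑' m : ℕ, (-1) ^ m / ((m ! : ℝ) * ((m + ν)! : ℝ)) * (x / 2) ^ (2 * m + ν)

/-- The series defining `J_ν` converges. -/
theorem summable_besselJ (ν : ℕ) (x : ℝ) :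
    Summable fun m : ℕ => (-1) ^ m / ((m ! : ℝ) * ((m + ν)! : ℝ)) * (x / 2) ^ (2 * m + ν) := by
  refine Summable.of_norm_bounded
    ((Real.summable_pow_div_factorial ((x / 2) ^ 2)).mul_right (|x / 2| ^ ν)) fun m => ?_
  have h1 : (1 : ℝ) ≤ ((m + ν)! : ℝ) := by
    exact_mod_cast Nat.one_le_iff_ne_zero.2 (Nat.factorial_ne_zero _)
  have h0 : (0 : ℝ) < (m ! : ℝ) := by exact_mod_cast Nat.factorial_pos m
  rw [norm_mul, norm_div, norm_pow, norm_neg, norm_one, one_pow, norm_pow, Real.norm_eq_abs,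
    Real.norm_eq_abs, abs_of_pos (by positivity), pow_add, pow_mul, sq_abs, one_div, ← mul_assoc,
    div_eq_inv_mul]
  have h2 : ((m ! : ℝ) * ((m + ν)! : ℝ))⁻¹ ≤ (m ! : ℝ)⁻¹ :=
    inv_anti₀ h0 (le_mul_of_one_le_right h0.le h1)
  rw [div_eq_inv_mul _ (m ! : ℝ)]
  gcongr

/-- The function `x ↦ J_ν(x) / x^ν`, with its limit `1 / (2^ν ν!)` at the removable
singularity `x = 0`. -/
def besselQuot (ν : ℕ) (x : ℝ) : ℝ :=
  if x = 0 then 1 / (2 ^ ν * (ν ! : ℝ)) else besselJ ν x / x ^ ν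

/-- The ray `R_k = {(λ, τ) : τ = (2k + n)|λ|}`. -/
def fanRay (n k : ℕ) : Set (EuclideanSpace ℝ (Fin 2)) :=
  {a | a 1 = (2 * k + n) * |a 0|}

/-- The limiting ray `R_∞ = {(0, τ) : τ ≥ 0}`. -/
def fanLimitRay : Set (EuclideanSpace ℝ (Fin 2)) :=
  {a | a 0 = 0 ∧ 0 ≤ a 1}

/-- The Heisenberg fan `Ω`, with the Euclidean metric of `ℝ²`. -/
def heisenbergFan (n : ℕ) : Set (EuclideanSpace ℝ (Fin 2)) :=
  (⋃ k : ℕ, fanRay n k) ∪ fanLimitRay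

/-- For `a = (λ, τ)` in the fan with `λ ≠ 0`, the `k` with `a ∈ R_k`; it is
unique by `fanIndex_eq`. -/
def fanIndex (n : ℕ) (a : EuclideanSpace ℝ (Fin 2)) : ℕ :=
  sInf {k : ℕ | a ∈ fanRay n k}

theorem fanIndex_eq {n k : ℕ} {a : EuclideanSpace ℝ (Fin 2)} (ha : a ∈ fanRay n k)
    (h0 : a 0 ≠ 0) : fanIndex n a = k := by
  have h : {j : ℕ | a ∈ fanRay n j} = {k} := by
    ext j
    refine ⟨fun hj => ?_, fun hj => by rw [Set.mem_singleton_iff.1 hj]; exact ha⟩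
    have h1 : ((2 * j + n : ℝ)) * |a 0| = (2 * k + n) * |a 0| := by
      rw [← show a 1 = _ from hj, ← show a 1 = _ from ha]
    have h2 := mul_right_cancel₀ (abs_ne_zero.2 h0) h1
    have h3 : (j : ℝ) = k := by linarith
    exact_mod_cast h3
  rw [fanIndex, h, csInf_singleton]

/-- The Laguerre function
`φ_{k,λ}^{n-1}(z) = L_k^{n-1}(½ |λ| |z|²) exp (-¼ |λ| |z|²)`. -/
def laguerreFun (n k : ℕ) (lam : ℝ) (z : EuclideanSpace ℂ (Fin n)) : ℝ :=
  laguerreL (n - 1) k (1 / 2 * |lam| * ‖z‖ ^ 2) * Real.exp (-(1 / 4) * |lam| * ‖z‖ ^ 2)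

/-- The joint eigenfunction `e_{k,λ}^{n-1}(z, t) = e^{iλt} φ_{k,λ}^{n-1}(z)`. -/
def laguerreEigen (n k : ℕ) (lam : ℝ) (g : Heisenberg n) : ℂ :=
  Complex.exp (Complex.I * lam * g.2) * laguerreFun n k lam g.1

/-- The function
`χ_τ(z, t) = (n-1)! 2^{n-1} J_{n-1}(√τ |z|) / (√τ |z|)^{n-1}`. -/
def besselEigen (n : ℕ) (τ : ℝ) (g : Heisenberg n) : ℂ :=
  (((n - 1)! * 2 ^ (n - 1) * besselQuot (n - 1) (√τ * ‖g.1‖) : ℝ) : ℂ)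

/-- For `a ∈ Ω`: `e_a = e_{k,λ}^{n-1}` if `a = (λ, (2k + n)|λ|)` with `λ ≠ 0`, and
`e_a = χ_τ` if `a = (0, τ)`. -/
def fanEigen (n : ℕ) (a : EuclideanSpace ℝ (Fin 2)) (g : Heisenberg n) : ℂ :=
  if a 0 = 0 then besselEigen n (a 1) g else laguerreEigen n (fanIndex n a) (a 0) g

/-- The Strichartz Fourier transform
`f̂(a, z) = ∫ f(w, s) e_a((w, s)⁻¹(z, 0)) dw ds`, `a ∈ Ω`. -/
def strichartz {n : ℕ} (f : Heisenberg n → ℂ) (a : EuclideanSpace ℝ (Fin 2))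
    (z : EuclideanSpace ℂ (Fin n)) : ℂ :=
  ∫ g : Heisenberg n, f g * fanEigen n a (g⁻¹ * Heisenberg.mk z 0)

/-- The normalised Strichartz Fourier transform: `k! (n-1)! / (k+n-1)! · f̂(a, z)` for
`a ∈ R_k` off the limiting ray, and `f̂(a, z)` on the limiting ray. -/
def normStrichartz {n : ℕ} (f : Heisenberg n → ℂ) (a : EuclideanSpace ℝ (Fin 2))
    (z : EuclideanSpace ℂ (Fin n)) : ℂ :=
  if a 0 = 0 then strichartz f a z
  else ((((fanIndex n a)! * (n - 1)! : ℝ) / ((fanIndex n a + n - 1)! : ℝ) : ℝ) : ℂ) *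
    strichartz f a z

end

/-! After normalisation, `e_a` on the sphere `|z| = r` is `e^{iλt}` times one kernel `fanKernel`,
evaluated at a point depending continuously on `a` and `r`. On `y = k x` the product `∏_{i<j} (y - i
x)` is `k(k-1)⋯(k-j+1) x^j`, which gives Laguerre functions; on `x = 0` it is `y^j`, which gives the
Bessel function. Both are at most `y^j` in modulus, so the series converges locally uniformly and
the kernel is continuous across the limiting ray (`continuousOn_fanKernel`).

The analytic core is a bound for the normalised Laguerre functions, uniform in `k`, and their decay
as `(2k + d + 1) x → ∞`, also uniform in `k` (`exists_abs_normLaguerreFun_le`). Both follow from the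
differential equation alone: an energy controls `x ≤ N`, a Sonin functional gives decay up to the
turning point `2N`, and `u²` decreases beyond it. The limiting ray inherits the bounds by
continuity.

Dominated convergence then gives continuity and vanishing at infinity. As the fan is closed in the
plane, a continuous function on it with a limit at infinity is uniformly continuous. -/

/-! ### Estimates for decaying solutions of the Laguerre equation -/

/-- The Sonin-type functional `(2xu')² + u (2xu') + (d + ½) u² + x (2N - x) u²`. -/
noncomputable def soninFun (u v : ℝ → ℝ) (d : ℕ) (N x : ℝ) : ℝ :=
  (2 * x * v x) ^ 2 + u x * (2 * x * v x) + (d + 1 / 2) * u x ^ 2 + x * (2 * N - x) * u x ^ 2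

/-- `u` is a solution, with derivatives `v = u'` and `w = u''`, of the equation
`x u'' + (d + 1) u' + (N / 2 - x / 4) u = 0` of the Laguerre functions, normalised by `u 0 = 1`
and decaying at infinity. -/
structure IsLaguerreSolution (u v w : ℝ → ℝ) (d : ℕ) (N : ℝ) : Prop where
  hasDerivAt_fst : ∀ x, HasDerivAt u (v x) x
  hasDerivAt_snd : ∀ x, HasDerivAt v (w x) x
  ode : ∀ x, x * w x + (d + 1) * v x + (N / 2 - x / 4) * u x = 0
  zero : u 0 = 1
  one_le : 1 ≤ N
  tendsto : Tendsto (fun x => x ^ (d + 1) * (u x * v x)) atTop (𝓝 0)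

namespace IsLaguerreSolution

variable {u v w : ℝ → ℝ} {d : ℕ} {N : ℝ}

/-- Multiplying the equation by `2u'` shows that the derivative of this energy is `-(2d + 1) u'² -
u²/4`. -/
theorem antitone_energy (h : IsLaguerreSolution u v w d N) :
    Antitone fun x => x * v x ^ 2 + (N / 2 - x / 4) * u x ^ 2 := by
  have hd : ∀ x, HasDerivAt (fun x => x * v x ^ 2 + (N / 2 - x / 4) * u x ^ 2)
      (-(2 * d + 1) * v x ^ 2 - u x ^ 2 / 4) x := fun x => by
    refine ((((hasDerivAt_id' x).mul ((h.hasDerivAt_snd x).pow 2)).add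
      ((((hasDerivAt_id' x).div_const 4).const_sub (N / 2)).mul
        ((h.hasDerivAt_fst x).pow 2)))).congr_deriv ?_
    simp only [Pi.pow_apply]
    push_cast
    linear_combination 2 * v x * h.ode x
  refine antitone_of_deriv_nonpos (fun x => (hd x).differentiableAt) fun x => ?_
  rw [(hd x).deriv]
  nlinarith [sq_nonneg (u x), mul_nonneg (Nat.cast_nonneg (α := ℝ) d) (sq_nonneg (v x)),
    sq_nonneg (v x)]

theorem energy_le (h : IsLaguerreSolution u v w d N) {x : ℝ} (hx : 0 ≤ x) :
    x * v x ^ 2 + (N / 2 - x / 4) * u x ^ 2 ≤ N / 2 := by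
  simpa [h.zero] using h.antitone_energy hx

theorem sq_le_two (h : IsLaguerreSolution u v w d N) {x : ℝ} (hx : 0 ≤ x) (hxN : x ≤ N) :
    u x ^ 2 ≤ 2 := by
  have h1 := h.energy_le hx
  have h2 := h.one_le
  have h3 : N / 4 * u x ^ 2 ≤ (N / 2 - x / 4) * u x ^ 2 := by gcongr; linarith
  have h4 := mul_nonneg hx (sq_nonneg (v x))
  by_contra! hc
  nlinarith

/-- With `θ = 2x d/dx` the equation reads `θ²u + 2d θu + x(2N - x)u = 0`. The terms `u θu + (d +
1/2) u²` added to the energy `(θu)² + x(2N - x)u²` are chosen so that `θJ` is `J` minus nonnegative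
terms. -/
theorem hasDerivAt_sonin (h : IsLaguerreSolution u v w d N) (x : ℝ) :
    ∃ J', HasDerivAt (soninFun u v d N) J' x ∧ 2 * x * J' = soninFun u v d N x
      - 4 * d * (2 * x * v x) ^ 2 - (2 * x ^ 2 + d + 1 / 2) * u x ^ 2 := by
  have hp : HasDerivAt (fun x => 2 * x * v x) (2 * v x + 2 * x * w x) x :=
    (((hasDerivAt_id' x).const_mul 2).mul (h.hasDerivAt_snd x)).congr_deriv (by ring)
  have hr : HasDerivAt (fun x => x * (2 * N - x)) (2 * N - 2 * x) x :=
    ((hasDerivAt_id' x).mul ((hasDerivAt_id' x).const_sub (2 * N))).congr_deriv (by ring)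
  refine ⟨_, (((hp.pow 2).add ((h.hasDerivAt_fst x).mul hp)).add
    (((h.hasDerivAt_fst x).pow 2).const_mul (d + 1 / 2 : ℝ))).add
    (hr.mul ((h.hasDerivAt_fst x).pow 2)), ?_⟩
  simp only [soninFun]
  push_cast
  linear_combination (16 * x ^ 2 * v x + 4 * x * u x) * h.ode x

/-- Since `θ√x = √x`, the inequality `θJ ≤ J` says exactly that `J/√x` does not increase. -/
theorem antitoneOn_sonin (h : IsLaguerreSolution u v w d N) :
    AntitoneOn (fun x => soninFun u v d N x / √x) (Set.Ioi 0) := by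
  have hd : ∀ x ∈ Set.Ioi (0 : ℝ), ∃ c ≤ 0,
      HasDerivAt (fun x => soninFun u v d N x / √x) c x := fun x hx => by
    have hx : 0 < x := hx
    obtain ⟨J', hJ, hJ'⟩ := h.hasDerivAt_sonin x
    have hs : 0 < √x := Real.sqrt_pos.2 hx
    refine ⟨_, ?_, hJ.div (Real.hasDerivAt_sqrt hx.ne') hs.ne'⟩
    refine div_nonpos_of_nonpos_of_nonneg ?_ (sq_nonneg _)
    have h1 : 2 * x * J' ≤ soninFun u v d N x := by
      rw [hJ']
      have : 0 ≤ 4 * d * (2 * x * v x) ^ 2 := by positivity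
      have : 0 ≤ (2 * x ^ 2 + d + 1 / 2) * u x ^ 2 := by positivity
      linarith
    rw [sub_nonpos, mul_one_div, le_div_iff₀ (by positivity)]
    calc J' * √x * (2 * √x) = 2 * (√x * √x) * J' := by ring
      _ ≤ _ := by rwa [Real.mul_self_sqrt hx.le]
  refine antitoneOn_of_deriv_nonpos (convex_Ioi 0)
    (fun x hx => (hd x hx).choose_spec.2.continuousAt.continuousWithinAt)
    (fun x hx => ?_) fun x hx => ?_
  · rw [interior_Ioi] at hx
    exact (hd x hx).choose_spec.2.differentiableAt.differentiableWithinAt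
  · rw [interior_Ioi] at hx
    rw [(hd x hx).choose_spec.2.deriv]
    exact (hd x hx).choose_spec.1

/-- At `x = 1/N` the first energy gives `u² ≤ 2` and `(2xu')² ≤ 4x · N/2 = 2`. The four terms of the
functional are then at most `2`, `2`, `2d + 1` and `4`. -/
theorem sonin_inv_le (h : IsLaguerreSolution u v w d N) :
    soninFun u v d N N⁻¹ ≤ 2 * d + 9 := by
  have hN := h.one_le
  have hN0 : 0 < N := by linarith
  have hy : 0 < N⁻¹ := inv_pos.2 hN0
  have hy1 : N⁻¹ ≤ 1 := inv_le_one_of_one_le₀ hN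
  have hyN : N⁻¹ * N = 1 := inv_mul_cancel₀ hN0.ne'
  have hu := h.sq_le_two hy.le (hy1.trans hN)
  have hE := h.energy_le hy.le
  have hp : (2 * N⁻¹ * v N⁻¹) ^ 2 ≤ 2 := by
    have h1 : 0 ≤ (N / 2 - N⁻¹ / 4) * u N⁻¹ ^ 2 := mul_nonneg (by linarith) (sq_nonneg _)
    calc (2 * N⁻¹ * v N⁻¹) ^ 2 = 4 * N⁻¹ * (N⁻¹ * v N⁻¹ ^ 2) := by ring
      _ ≤ 4 * N⁻¹ * (N / 2) := by gcongr; linarith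
      _ = 2 := by linear_combination 2 * hyN
  have hr : N⁻¹ * (2 * N - N⁻¹) * u N⁻¹ ^ 2 ≤ 2 * 2 := by
    gcongr
    nlinarith
  have hd : (d + 1 / 2 : ℝ) * u N⁻¹ ^ 2 ≤ (d + 1 / 2) * 2 := by gcongr
  rw [soninFun]
  nlinarith [sq_nonneg (u N⁻¹ - 2 * N⁻¹ * v N⁻¹)]

theorem sonin_le (h : IsLaguerreSolution u v w d N) {x : ℝ} (hx : N⁻¹ ≤ x) :
    soninFun u v d N x ≤ (2 * d + 9) * √(x * N) := by
  have hN0 : 0 < N := by linarith [h.one_le]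
  have hy : 0 < N⁻¹ := inv_pos.2 hN0
  have hx0 : 0 < x := hy.trans_le hx
  have h1 := h.antitoneOn_sonin hy hx0 hx
  have hs : 0 < √x := Real.sqrt_pos.2 hx0
  simp only [Real.sqrt_inv, div_inv_eq_mul] at h1
  rw [div_le_iff₀ hs] at h1
  refine h1.trans ?_
  rw [Real.sqrt_mul hx0.le, mul_assoc, mul_comm √N]
  gcongr
  exact h.sonin_inv_le

/-- With `p = 2xu'`, the remaining terms dominate `p² + up + u²/2 = (p² + (u + p)²)/2 ≥ 0`. -/
theorem sq_mul_le (h : IsLaguerreSolution u v w d N) {x : ℝ} (hx : N⁻¹ ≤ x) :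
    x * (2 * N - x) * u x ^ 2 ≤ (2 * d + 9) * √(x * N) := by
  refine le_trans ?_ (h.sonin_le hx)
  have : 0 ≤ (d : ℝ) * u x ^ 2 := by positivity
  rw [soninFun]
  nlinarith [sq_nonneg (u x + 2 * x * v x), sq_nonneg (2 * x * v x)]

theorem sq_mul_sqrt_le (h : IsLaguerreSolution u v w d N) {x : ℝ} (hx : N⁻¹ ≤ x) (hxN : x ≤ N) :
    u x ^ 2 * √(x * N) ≤ 2 * d + 9 := by
  have hN0 : 0 < N := by linarith [h.one_le]
  have hx0 : 0 < x := (inv_pos.2 hN0).trans_le hx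
  have hs : 0 < √(x * N) := Real.sqrt_pos.2 (by positivity)
  refine le_of_mul_le_mul_right ?_ hs
  refine le_trans ?_ (h.sq_mul_le hx)
  rw [mul_assoc, Real.mul_self_sqrt (by positivity), mul_comm]
  gcongr
  linarith

theorem sqrt_mul_le_of_le {x : ℝ} (hN : 0 < N) (hx : N ≤ x) : √(x * N) ≤ x := by
  have : 0 ≤ x := hN.le.trans hx
  exact (Real.sqrt_le_sqrt (mul_le_mul_of_nonneg_left hx this)).trans_eq
    (Real.sqrt_mul_self this)

theorem sq_le_of_add_le (h : IsLaguerreSolution u v w d N) {x l : ℝ} (hl : 0 < l) (hx : N ≤ x)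
    (hxl : x + l ≤ 2 * N) : u x ^ 2 ≤ (2 * d + 9) / l := by
  have hN0 : 0 < N := by linarith [h.one_le]
  have hx0 : 0 < x := hN0.trans_le hx
  have h1 := h.sq_mul_le ((inv_le_one_of_one_le₀ h.one_le).trans (h.one_le.trans hx))
  have h2 : x * (2 * N - x) * u x ^ 2 ≤ (2 * d + 9) * x :=
    h1.trans (by gcongr; exact sqrt_mul_le_of_le hN0 hx)
  rw [le_div_iff₀ hl]
  refine le_of_mul_le_mul_left ?_ hx0
  calc x * (u x ^ 2 * l) = x * l * u x ^ 2 := by ring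
    _ ≤ x * (2 * N - x) * u x ^ 2 := by gcongr; linarith
    _ ≤ x * (2 * d + 9) := by linarith

/-- Up to the turning point the potential term is nonnegative, and the sum of squares in the
functional still leaves `(2xu')²/2`. -/
theorem deriv_sq_le (h : IsLaguerreSolution u v w d N) {x : ℝ} (hx : N ≤ x) (hx2 : x ≤ 2 * N) :
    v x ^ 2 ≤ (2 * d + 9) / (2 * N) := by
  have hN0 : 0 < N := by linarith [h.one_le]
  have hx0 : 0 < x := hN0.trans_le hx
  have h1 := h.sonin_le ((inv_le_one_of_one_le₀ h.one_le).trans (h.one_le.trans hx))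
  have h2 : soninFun u v d N x ≤ (2 * d + 9) * x :=
    h1.trans (by gcongr; exact sqrt_mul_le_of_le hN0 hx)
  have h3 : (2 * x * v x) ^ 2 / 2 ≤ soninFun u v d N x := by
    have : 0 ≤ (d : ℝ) * u x ^ 2 := by positivity
    have : 0 ≤ x * (2 * N - x) * u x ^ 2 :=
      mul_nonneg (mul_nonneg hx0.le (by linarith)) (sq_nonneg _)
    rw [soninFun]
    nlinarith [sq_nonneg (u x + 2 * x * v x)]
  rw [le_div_iff₀ (by positivity)]
  have h4 : v x ^ 2 * (2 * x) ≤ 2 * d + 9 := by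
    refine le_of_mul_le_mul_left ?_ hx0
    calc x * (v x ^ 2 * (2 * x)) = (2 * x * v x) ^ 2 / 2 := by ring
      _ ≤ _ := by linarith
  exact le_trans (by gcongr) h4

/-- The factor `2N - x` degenerates at the turning point. Within distance `l` of it, `u` is compared
with its value at `2N - l`, at a cost of `l` times the bound on `|u'|`. -/
theorem sq_le_of_le_two_mul (h : IsLaguerreSolution u v w d N) {x l : ℝ} (hl : 0 < l)
    (hlN : l ≤ N) (hx : N ≤ x) (hx2 : x ≤ 2 * N) :
    u x ^ 2 ≤ 2 * (2 * d + 9) / l + l ^ 2 * (2 * d + 9) / N := by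
  have hN0 : 0 < N := by linarith [h.one_le]
  rcases le_total (x + l) (2 * N) with hxl | hxl
  · have h1 := h.sq_le_of_add_le hl hx hxl
    have : 0 ≤ l ^ 2 * (2 * d + 9) / N := by positivity
    have h2 : 0 ≤ (2 * d + 9) / l := by positivity
    have h3 : 2 * (2 * d + 9) / l = (2 * d + 9) / l + (2 * d + 9) / l := by ring
    linarith
  · set y := 2 * N - l with hy
    have hyx : y ≤ x := by linarith
    have h1 : u y ^ 2 ≤ (2 * d + 9) / l := h.sq_le_of_add_le hl (by linarith) (by linarith)
    have h2 : |u x - u y| ≤ √((2 * d + 9) / (2 * N)) * |x - y| := by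
      refine Convex.norm_image_sub_le_of_norm_hasDerivWithin_le (s := Set.Icc N (2 * N))
        (f' := v) (fun z _ => (h.hasDerivAt_fst z).hasDerivWithinAt) (fun z hz => ?_)
        (convex_Icc _ _) ⟨by linarith, by linarith⟩ ⟨hx, hx2⟩
      exact Real.abs_le_sqrt (h.deriv_sq_le hz.1 hz.2)
    have h3 : (u x - u y) ^ 2 ≤ l ^ 2 * ((2 * d + 9) / (2 * N)) := by
      rw [← sq_abs]
      calc |u x - u y| ^ 2 ≤ (√((2 * d + 9) / (2 * N)) * |x - y|) ^ 2 := by gcongr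
        _ = (x - y) ^ 2 * ((2 * d + 9) / (2 * N)) := by
          rw [mul_pow, Real.sq_sqrt (by positivity), sq_abs, mul_comm]
        _ ≤ _ := by
          have : 0 ≤ x - y := by linarith
          gcongr
          linarith
    have h4 : u x ^ 2 ≤ 2 * u y ^ 2 + 2 * (u x - u y) ^ 2 := by
      nlinarith [sq_nonneg (2 * u y - u x)]
    have h5 : 2 * (2 * d + 9) / l = 2 * ((2 * d + 9) / l) := by ring
    have h6 : l ^ 2 * (2 * d + 9) / N = 2 * (l ^ 2 * ((2 * d + 9) / (2 * N))) := by
      field_simp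
    rw [h5, h6]
    linarith

/-- Beyond the turning point `x^{d+1} u u'` is nondecreasing, because the potential has changed
sign. It tends to `0`, so `u u' ≤ 0` and `u²` decreases. -/
theorem sq_le_sq_of_two_mul_le (h : IsLaguerreSolution u v w d N) {x : ℝ} (hx : 2 * N ≤ x) :
    u x ^ 2 ≤ u (2 * N) ^ 2 := by
  have hN0 : 0 < N := by linarith [h.one_le]
  have hd : ∀ x, HasDerivAt (fun x => x ^ (d + 1) * (u x * v x))
      (x ^ d * (x * v x ^ 2 - (N / 2 - x / 4) * u x ^ 2)) x := fun x => by
    refine ((hasDerivAt_pow (d + 1) x).mul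
      ((h.hasDerivAt_fst x).mul (h.hasDerivAt_snd x))).congr_deriv ?_
    simp only [Nat.add_sub_cancel, Pi.mul_apply]
    push_cast
    linear_combination x ^ d * u x * h.ode x
  have hmono : MonotoneOn (fun x => x ^ (d + 1) * (u x * v x)) (Set.Ici (2 * N)) := by
    refine monotoneOn_of_deriv_nonneg (convex_Ici _)
      (fun x _ => (hd x).continuousAt.continuousWithinAt)
      (fun x _ => (hd x).differentiableAt.differentiableWithinAt) fun x hx => ?_
    rw [interior_Ici] at hx
    have hx : 2 * N < x := hx
    have hx0 : 0 < x := by linarith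
    rw [(hd x).deriv]
    refine mul_nonneg (by positivity) ?_
    have h1 : (N / 2 - x / 4) * u x ^ 2 ≤ 0 :=
      mul_nonpos_of_nonpos_of_nonneg (by linarith) (sq_nonneg _)
    have : 0 ≤ x * v x ^ 2 := by positivity
    linarith
  have hneg : ∀ x, 2 * N ≤ x → u x * v x ≤ 0 := fun x hx => by
    have hx0 : 0 < x := by linarith
    have h1 : x ^ (d + 1) * (u x * v x) ≤ 0 := by
      refine ge_of_tendsto h.tendsto ?_
      filter_upwards [eventually_ge_atTop x] with y hy
      exact hmono hx (hx.trans hy) hy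
    exact nonpos_of_mul_nonpos_right h1 (by positivity)
  have hd2 : ∀ x, HasDerivAt (fun x => u x ^ 2) (2 * (u x * v x)) x := fun x =>
    ((h.hasDerivAt_fst x).pow 2).congr_deriv (by push_cast; ring)
  refine antitoneOn_of_deriv_nonpos (convex_Ici (2 * N))
    (fun x _ => (hd2 x).continuousAt.continuousWithinAt)
    (fun x _ => (hd2 x).differentiableAt.differentiableWithinAt) (fun x hx => ?_)
    Set.self_mem_Ici hx hx
  rw [interior_Ici] at hx
  rw [(hd2 x).deriv]
  linarith [hneg x (le_of_lt hx)]

theorem sq_le_of_le (h : IsLaguerreSolution u v w d N) {x l : ℝ} (hl : 0 < l) (hlN : l ≤ N)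
    (hx : N ≤ x) : u x ^ 2 ≤ 2 * (2 * d + 9) / l + l ^ 2 * (2 * d + 9) / N := by
  rcases le_total x (2 * N) with hx2 | hx2
  · exact h.sq_le_of_le_two_mul hl hlN hx hx2
  · exact (h.sq_le_sq_of_two_mul_le hx2).trans
      (h.sq_le_of_le_two_mul hl hlN (by linarith [h.one_le]) le_rfl)

theorem sq_le (h : IsLaguerreSolution u v w d N) {x : ℝ} (hx : 0 ≤ x) :
    u x ^ 2 ≤ 3 * (2 * d + 9) := by
  have hd : (0 : ℝ) ≤ d := Nat.cast_nonneg d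
  rcases le_total x N with hxN | hxN
  · linarith [h.sq_le_two hx hxN]
  · have h1 := h.sq_le_of_le one_pos h.one_le hxN
    have h2 : 1 ^ 2 * (2 * d + 9) / N ≤ 2 * d + 9 := by
      rw [one_pow, one_mul]
      exact div_le_self (by positivity) h.one_le
    linarith

end IsLaguerreSolution

/-! ### Normalised Laguerre functions: equation, uniform bound, uniform decay -/

open scoped Polynomial

/-- The coefficients `(-1)^j d! / (j! (d + j)!)` of the normalised Bessel function. -/
noncomputable def besselCoeff (d j : ℕ) : ℝ := (-1) ^ j * (d ! : ℝ) / ((j ! : ℝ) * ((d + j)! : ℝ))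

theorem besselCoeff_zero (d : ℕ) : besselCoeff d 0 = 1 := by
  have : (d ! : ℝ) ≠ 0 := by positivity
  simp [besselCoeff, this]

theorem besselCoeff_succ (d j : ℕ) :
    besselCoeff d (j + 1) * ((j + 1) * (d + j + 1)) = -besselCoeff d j := by
  have h1 : (j ! : ℝ) ≠ 0 := by positivity
  have h2 : ((d + j)! : ℝ) ≠ 0 := by positivity
  have h3 : (j + 1 : ℝ) ≠ 0 := by positivity
  have h4 : (d + j + 1 : ℝ) ≠ 0 := by positivity
  rw [besselCoeff, besselCoeff, ← add_assoc, Nat.factorial_succ, Nat.factorial_succ]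
  push_cast
  field_simp
  ring

theorem abs_besselCoeff_le (d j : ℕ) : |besselCoeff d j| ≤ 1 / (j ! : ℝ) := by
  have h1 : (0 : ℝ) < j ! := by positivity
  have h2 : (d ! : ℝ) ≤ ((d + j)! : ℝ) := by exact_mod_cast Nat.factorial_le (Nat.le_add_right d j)
  have h3 : (0 : ℝ) < (d + j)! := by positivity
  rw [besselCoeff, abs_div, abs_mul, abs_pow, abs_neg, abs_one, one_pow, one_mul,
    abs_of_nonneg (by positivity), abs_of_nonneg (by positivity),
    div_le_div_iff₀ (by positivity) h1, one_mul, mul_comm]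
  gcongr

theorem cast_descFactorial_succ_real (k m : ℕ) :
    (k.descFactorial (m + 1) : ℝ) = (k - m) * k.descFactorial m := by
  rw [Nat.descFactorial_succ]
  rcases le_or_gt m k with h | h
  · push_cast [h]; ring
  · simp [Nat.descFactorial_of_lt h]

/-- The Laguerre polynomial `L_k^d` divided by its value at `0`. -/
noncomputable def normLaguerrePoly (d k : ℕ) : ℝ[X] :=
  ∑ j ∈ Finset.range (k + 1), Polynomial.monomial j (besselCoeff d j * k.descFactorial j)

theorem coeff_normLaguerrePoly (d k m : ℕ) :
    (normLaguerrePoly d k).coeff m = besselCoeff d m * k.descFactorial m := by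
  rw [normLaguerrePoly, Polynomial.finsetSum_coeff]
  simp only [Polynomial.coeff_monomial, Finset.sum_ite_eq', Finset.mem_range]
  split_ifs with h
  · rfl
  · rw [Nat.descFactorial_of_lt (by omega)]; simp

/-- Comparing coefficients reduces the equation to the recurrence `besselCoeff_succ`; the constant
term is separate because multiplication by `X` shifts degrees. -/
theorem normLaguerrePoly_ode (d k : ℕ) :
    Polynomial.X * (normLaguerrePoly d k).derivative.derivative
      + (((d + 1 : ℕ) : ℝ[X]) - Polynomial.X) * (normLaguerrePoly d k).derivative
      + (k : ℝ[X]) * normLaguerrePoly d k = 0 := by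
  ext m
  rw [sub_mul, Polynomial.coeff_add, Polynomial.coeff_add, Polynomial.coeff_sub,
    Polynomial.coeff_natCast_mul, Polynomial.coeff_natCast_mul]
  rcases m with _ | m
  · simp only [Polynomial.mul_coeff_zero, Polynomial.coeff_X_zero, Polynomial.coeff_derivative,
      coeff_normLaguerrePoly, Polynomial.coeff_zero, cast_descFactorial_succ_real]
    have h := besselCoeff_succ d 0
    push_cast at h ⊢
    linear_combination (k * k.descFactorial 0 : ℝ) * h
  · simp only [Polynomial.coeff_X_mul, Polynomial.coeff_derivative,
      coeff_normLaguerrePoly, Polynomial.coeff_zero, cast_descFactorial_succ_real k (m + 1)]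
    have h := besselCoeff_succ d (m + 1)
    push_cast at h ⊢
    linear_combination ((k - (m + 1)) * k.descFactorial (m + 1) : ℝ) * h

/-- The normalised Laguerre function `e^{-x/2} L_k^d(x) / L_k^d(0)`. -/
noncomputable def normLaguerreFun (d k : ℕ) (x : ℝ) : ℝ :=
  (normLaguerrePoly d k).eval x * Real.exp (-(x / 2))

theorem hasDerivAt_eval_mul_exp (p : ℝ[X]) (x : ℝ) :
    HasDerivAt (fun x => p.eval x * Real.exp (-(x / 2)))
      ((p.derivative - Polynomial.C (1 / 2) * p).eval x * Real.exp (-(x / 2))) x := by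
  refine ((p.hasDerivAt x).mul ((((hasDerivAt_id' x).div_const 2).neg).exp)).congr_deriv ?_
  simp only [Polynomial.eval_sub, Polynomial.eval_mul, Polynomial.eval_C, Pi.neg_apply]
  ring

theorem isLaguerreSolution_normLaguerreFun (d k : ℕ) :
    ∃ v w, IsLaguerreSolution (normLaguerreFun d k) v w d (2 * k + d + 1) := by
  set p := normLaguerrePoly d k with hp
  refine ⟨_, _, hasDerivAt_eval_mul_exp p, hasDerivAt_eval_mul_exp _, fun x => ?_, ?_, ?_, ?_⟩
  · have h := congrArg (Polynomial.eval x) (normLaguerrePoly_ode d k)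
    rw [← hp] at h
    simp only [Polynomial.eval_add, Polynomial.eval_mul, Polynomial.eval_sub, Polynomial.eval_X,
      Polynomial.eval_natCast, Polynomial.eval_zero, Polynomial.derivative_sub,
      Polynomial.derivative_C_mul, Polynomial.eval_C, normLaguerreFun, ← hp] at h ⊢
    push_cast at h
    linear_combination Real.exp (-(x / 2)) * h
  · have h := coeff_normLaguerrePoly d k 0
    rw [Polynomial.coeff_zero_eq_eval_zero] at h
    simp [normLaguerreFun, h, besselCoeff_zero]
  · have h1 : (0 : ℝ) ≤ d := Nat.cast_nonneg d
    have h2 : (0 : ℝ) ≤ k := Nat.cast_nonneg k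
    linarith
  -- Each of `u` and `u'` is a polynomial times `e^{-x/2}`, so `x^{d+1} u u'` is a polynomial
  -- divided by `e^x`.
  · refine (Polynomial.tendsto_div_exp_atTop (Polynomial.X ^ (d + 1) *
      (p * (p.derivative - Polynomial.C (1 / 2) * p)))).congr fun x => ?_
    have : Real.exp (-(x / 2)) * Real.exp (-(x / 2)) = (Real.exp x)⁻¹ := by
      rw [← Real.exp_add, ← Real.exp_neg]; ring_nf
    simp only [Polynomial.eval_mul, Polynomial.eval_pow, Polynomial.eval_X, normLaguerreFun,
      div_eq_mul_inv, ← this]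
    ring

theorem tendsto_normLaguerreFun_sq (d k : ℕ) :
    Tendsto (fun x => normLaguerreFun d k x ^ 2) atTop (𝓝 0) := by
  refine (Polynomial.tendsto_div_exp_atTop (normLaguerrePoly d k ^ 2)).congr fun x => ?_
  have : Real.exp (-(x / 2)) ^ 2 = (Real.exp x)⁻¹ := by
    rw [← Real.exp_nat_mul, ← Real.exp_neg]; push_cast; ring_nf
  rw [normLaguerreFun, mul_pow, this, Polynomial.eval_pow, div_eq_mul_inv]

theorem abs_normLaguerreFun_le (d k : ℕ) {x : ℝ} (hx : 0 ≤ x) :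
    |normLaguerreFun d k x| ≤ √(3 * (2 * d + 9)) := by
  obtain ⟨v, w, h⟩ := isLaguerreSolution_normLaguerreFun d k
  exact Real.abs_le_sqrt (h.sq_le hx)

/-- The normalised Laguerre functions decay as `(2k + d + 1) x → ∞`, uniformly in `k`. -/
theorem exists_abs_normLaguerreFun_le (d : ℕ) {ε : ℝ} (hε : 0 < ε) :
    ∃ M, ∀ (k : ℕ) (x : ℝ), 0 ≤ x → M ≤ (2 * k + d + 1) * x → |normLaguerreFun d k x| ≤ ε := by
  have hd : (0 : ℝ) ≤ d := Nat.cast_nonneg d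
  obtain ⟨A, hA⟩ : ∃ A : ℝ, A = 2 * d + 9 := ⟨_, rfl⟩
  have hA0 : 0 < A := by linarith
  obtain ⟨η, hη⟩ : ∃ η : ℝ, η = ε ^ 2 := ⟨_, rfl⟩
  have hη0 : 0 < η := by rw [hη]; positivity
  -- This `l` makes `2A/l = η/2`. For `k ≥ k₀` one then has `l ≤ N` and `l² A/N ≤ η/2`; the finitely
  -- many `k < k₀` decay individually.
  obtain ⟨l, hl⟩ : ∃ l : ℝ, l = 4 * A / η := ⟨_, rfl⟩
  have hl0 : 0 < l := by rw [hl]; positivity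
  obtain ⟨k₀, hk₀⟩ := exists_nat_ge (max l (2 * l ^ 2 * A / η))
  obtain ⟨X, hX0, hX⟩ : ∃ X, 0 ≤ X ∧ ∀ x, X ≤ x → ∀ k ∈ Finset.range k₀,
      normLaguerreFun d k x ^ 2 ≤ η := by
    have h : ∀ᶠ x in atTop, ∀ k ∈ Finset.range k₀, normLaguerreFun d k x ^ 2 ≤ η :=
      (Filter.eventually_all_finset _).2 fun k _ =>
        (tendsto_normLaguerreFun_sq d k).eventually_le_const hη0
    obtain ⟨X, hX⟩ := eventually_atTop.1 h
    exact ⟨max X 0, le_max_right _ _, fun x hx => hX x ((le_max_left _ _).trans hx)⟩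
  -- The `1` ensures `x ≥ 1/N`, the square ensures `√(xN) ≥ A/η`, and the last entry forces `x ≥ X`
  -- when `k < k₀`.
  refine ⟨max (max 1 ((A / η) ^ 2)) (X * (2 * k₀ + d + 1)), fun k x hx hM => ?_⟩
  refine abs_le_of_sq_le_sq ?_ hε.le
  rw [← hη]
  rcases lt_or_ge k k₀ with hk | hk
  · refine hX x ?_ k (Finset.mem_range.2 hk)
    have hk' : (k : ℝ) ≤ k₀ := by exact_mod_cast hk.le
    have h1 : X * (2 * k₀ + d + 1) ≤ x * (2 * k₀ + d + 1) :=
      ((le_max_right _ _).trans hM).trans (by rw [mul_comm]; gcongr)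
    exact le_of_mul_le_mul_right h1 (by positivity)
  · obtain ⟨v, w, h⟩ := isLaguerreSolution_normLaguerreFun d k
    have hk' : (k₀ : ℝ) ≤ k := by exact_mod_cast hk
    set N : ℝ := 2 * k + d + 1 with hN
    have hN0 : 0 < N := by positivity
    have hkN : (k₀ : ℝ) ≤ N := by
      have : (0 : ℝ) ≤ k := Nat.cast_nonneg k
      linarith
    have hM1 := (le_max_left _ _).trans hM
    rcases le_total x N with hxN | hxN
    · have h1 : 1 ≤ N * x := (le_max_left _ _).trans hM1
      have h2 : A / η ≤ √(x * N) := by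
        refine Real.le_sqrt_of_sq_le ?_
        rw [mul_comm]
        exact (le_max_right _ _).trans hM1
      have h3 := h.sq_mul_sqrt_le (by rwa [inv_le_iff_one_le_mul₀' hN0]) hxN
      rw [← hA] at h3
      have h4 : normLaguerreFun d k x ^ 2 * (A / η) ≤ A :=
        (mul_le_mul_of_nonneg_left h2 (sq_nonneg _)).trans h3
      rw [mul_div_assoc', div_le_iff₀ hη0, mul_comm] at h4
      exact le_of_mul_le_mul_left h4 hA0
    · have h1 := h.sq_le_of_le hl0 (((le_max_left _ _).trans hk₀).trans hkN) hxN
      rw [← hA] at h1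
      have h2 : 2 * A / l = η / 2 := by rw [hl]; field_simp; ring
      have h3 : l ^ 2 * A / N ≤ η / 2 := by
        have h4 := ((le_max_right _ _).trans hk₀).trans hkN
        rw [div_le_iff₀ hη0] at h4
        rw [div_le_iff₀ hN0]
        linarith
      linarith

/-! ### The kernel joining Laguerre and Bessel functions -/

theorem prod_range_mul_sub_mul (k j : ℕ) (x : ℝ) :
    ∏ i ∈ Finset.range j, (k * x - i * x) = k.descFactorial j * x ^ j := by
  induction j with
  | zero => simp
  | succ j ih =>
    rw [Finset.prod_range_succ, ih, cast_descFactorial_succ_real]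
    ring

/-- The set of `(x, y)` with `x = 0` and `y ≥ 0`, or `x ≥ 0` and `y = k x` for some `k ∈ ℕ`. -/
def rayRegion : Set (ℝ × ℝ) := {p | 0 ≤ p.1 ∧ 0 ≤ p.2 ∧ (p.1 = 0 ∨ ∃ k : ℕ, p.2 = k * p.1)}

/-- This uses the integrality of `k`: on `y = k x` the product vanishes once `j > k`, before
negative factors can accumulate. -/
theorem abs_prod_range_sub_le {p : ℝ × ℝ} (hp : p ∈ rayRegion) (j : ℕ) :
    |∏ i ∈ Finset.range j, (p.2 - i * p.1)| ≤ p.2 ^ j := by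
  obtain ⟨h1, h2, h3 | ⟨k, h3⟩⟩ := hp
  · simp [h3, abs_of_nonneg h2]
  · rw [h3, prod_range_mul_sub_mul, abs_of_nonneg (by positivity), mul_pow]
    gcongr
    exact_mod_cast Nat.descFactorial_le_pow k j

/-- The function `(x, y) ↦ e^{-x/2} ∑_j (-1)^j d! / (j! (d + j)!) ∏_{i < j} (y - i x)`, which
interpolates between the normalised Laguerre functions (`y = k x`) and the normalised Bessel
function (`x = 0`). -/
noncomputable def fanKernel (d : ℕ) (p : ℝ × ℝ) : ℝ :=
  Real.exp (-(p.1 / 2)) * ∑' j, besselCoeff d j * ∏ i ∈ Finset.range j, (p.2 - i * p.1)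

theorem fanKernel_nat_mul (d k : ℕ) (x : ℝ) :
    fanKernel d (x, k * x) = normLaguerreFun d k x := by
  rw [fanKernel, normLaguerreFun, mul_comm, normLaguerrePoly, Polynomial.eval_finsetSum]
  simp only [prod_range_mul_sub_mul, Polynomial.eval_monomial]
  rw [tsum_eq_sum (s := Finset.range (k + 1))]
  · simp only [mul_assoc]
  · intro j hj
    rw [Finset.mem_range, not_lt] at hj
    rw [Nat.descFactorial_of_lt (by omega)]
    simp

theorem fanKernel_zero_left (d : ℕ) (s : ℝ) :
    fanKernel d (0, s ^ 2 / 4) = (d ! : ℝ) * 2 ^ d * besselQuot d s := by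
  have hd : (d ! : ℝ) ≠ 0 := by positivity
  simp only [fanKernel, zero_div, neg_zero, Real.exp_zero, one_mul, mul_zero, sub_zero,
    Finset.prod_const, Finset.card_range, besselQuot]
  split_ifs with hs
  · rw [tsum_eq_single 0]
    · simp only [besselCoeff_zero, pow_zero]
      field_simp
    · intro j hj
      simp [hs, hj]
  · rw [besselJ, mul_div_assoc', ← tsum_mul_left, ← tsum_div_const]
    refine tsum_congr fun m => ?_
    rw [besselCoeff, pow_add, pow_mul, div_pow s 2 2, div_pow s 2 d, add_comm m d]
    norm_num
    field_simp

/-- Near `p` the series is dominated by the exponential series at `p.2 + 1`, uniformly in the slope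
of the ray. -/
theorem continuousOn_fanKernel (d : ℕ) : ContinuousOn (fanKernel d) rayRegion := by
  intro p hp
  have h : ContinuousOn (fanKernel d) (rayRegion ∩ {q | q.2 < p.2 + 1}) := by
    refine ContinuousOn.mul (by fun_prop) ?_
    refine continuousOn_tsum (u := fun j => (p.2 + 1) ^ j / (j ! : ℝ)) (fun j => by fun_prop)
      (Real.summable_pow_div_factorial _) fun j q hq => ?_
    rw [norm_mul, Real.norm_eq_abs, Real.norm_eq_abs, div_eq_mul_one_div, mul_comm]
    have h1 := abs_prod_range_sub_le hq.1 j
    have h2 : q.2 ^ j ≤ (p.2 + 1) ^ j := pow_le_pow_left₀ hq.1.2.1 (le_of_lt hq.2) j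
    have h3 := abs_besselCoeff_le d j
    exact mul_le_mul (h1.trans h2) h3 (abs_nonneg _) ((abs_nonneg _).trans (h1.trans h2))
  refine (h p ⟨hp, by simp⟩).mono_of_mem_nhdsWithin ?_
  refine inter_mem self_mem_nhdsWithin (mem_nhdsWithin_of_mem_nhds ?_)
  exact (isOpen_lt continuous_snd continuous_const).mem_nhds (by simp)

/-- A bound for the normalised Laguerre functions passes to `fanKernel` on the region. -/
theorem abs_fanKernel_le_of_forall {d : ℕ} {c M : ℝ}
    (h : ∀ (k : ℕ) (x : ℝ), 0 ≤ x → M ≤ (2 * k + d + 1) * x → |normLaguerreFun d k x| ≤ c)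
    {p : ℝ × ℝ} (hp : p ∈ rayRegion) (hM : M ≤ 2 * p.2 + (d + 1) * p.1) :
    |fanKernel d p| ≤ c := by
  obtain ⟨x, y⟩ := p
  obtain ⟨h1, h2, h3 | ⟨k, h3⟩⟩ := id hp
  · simp only at h1 h2 h3 hM
    subst h3
    -- The point `(0, y)` is approached horizontally along the rays of slope `k + 1`. There `(2(k +
    -- 1) + d + 1) x = 2y + (d + 1) x ≥ 2y`, so the lower bound by `M` persists.
    have hmem : ∀ k : ℕ, (y / (k + 1 : ℕ), y) ∈ rayRegion := fun k =>
      ⟨by positivity, h2, Or.inr ⟨k + 1, (mul_div_cancel₀ y (by positivity)).symm⟩⟩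
    have ht : Tendsto (fun k : ℕ => (y / (k + 1 : ℕ), y)) atTop (𝓝[rayRegion] (0, y)) :=
      tendsto_nhdsWithin_iff.2 ⟨((tendsto_const_div_atTop_nhds_zero_nat y).comp
        (tendsto_add_atTop_nat 1)).prodMk_nhds tendsto_const_nhds, Eventually.of_forall hmem⟩
    refine le_of_tendsto (((continuousOn_fanKernel d (0, y) hp).tendsto.comp ht).abs)
      (Eventually.of_forall fun k => ?_)
    have hy : ((k + 1 : ℕ) : ℝ) * (y / (k + 1 : ℕ)) = y := mul_div_cancel₀ y (by positivity)
    have h4 := fanKernel_nat_mul d (k + 1) (y / (k + 1 : ℕ))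
    rw [hy] at h4
    simp only [Function.comp_apply, h4]
    refine h _ _ (by positivity) ?_
    have h5 : 0 ≤ (d + 1 : ℝ) * (y / (k + 1 : ℕ)) := by positivity
    linarith
  · simp only at h1 h2 h3 hM
    subst h3
    rw [fanKernel_nat_mul]
    exact h k x h1 (by linarith)

theorem abs_fanKernel_le (d : ℕ) {p : ℝ × ℝ} (hp : p ∈ rayRegion) :
    |fanKernel d p| ≤ √(3 * (2 * d + 9)) :=
  abs_fanKernel_le_of_forall (fun k _ hx _ => abs_normLaguerreFun_le d k hx) hp le_rfl

theorem exists_abs_fanKernel_le (d : ℕ) {ε : ℝ} (hε : 0 < ε) :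
    ∃ M, ∀ p ∈ rayRegion, M ≤ 2 * p.2 + (d + 1) * p.1 → |fanKernel d p| ≤ ε := by
  obtain ⟨M, hM⟩ := exists_abs_normLaguerreFun_le d hε
  exact ⟨M, fun p hp => abs_fanKernel_le_of_forall hM hp⟩

/-! ### The fan and its normalised eigenfunctions -/

theorem mul_laguerreL_eq (d k : ℕ) (x : ℝ) :
    (k ! * d ! : ℝ) / ((k + d)! : ℝ) * laguerreL d k x = (normLaguerrePoly d k).eval x := by
  rw [laguerreL, normLaguerrePoly, Polynomial.eval_finsetSum, Finset.mul_sum]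
  refine Finset.sum_congr rfl fun j hj => ?_
  have hj : j ≤ k := Nat.lt_succ_iff.1 (Finset.mem_range.1 hj)
  have h1 : ((k + d).choose (k - j) : ℝ) * ((k - j)! : ℝ) * ((d + j)! : ℝ) = ((k + d)! : ℝ) := by
    have h := Nat.choose_mul_factorial_mul_factorial (show k - j ≤ k + d by omega)
    rw [show k + d - (k - j) = d + j by omega] at h
    exact_mod_cast h
  have h2 : ((k - j)! : ℝ) * (k.descFactorial j : ℝ) = (k ! : ℝ) := by
    exact_mod_cast Nat.factorial_mul_descFactorial hj
  have h3 : ((k - j)! : ℝ) ≠ 0 := by positivity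
  have h4 : ((d + j)! : ℝ) ≠ 0 := by positivity
  have h5 : ((k + d).choose (k - j) : ℝ) ≠ 0 := by
    exact_mod_cast (Nat.choose_pos (show k - j ≤ k + d by omega)).ne'
  rw [Polynomial.eval_monomial, besselCoeff, ← h1, ← h2]
  field_simp

/-- The argument of `fanKernel` at which the normalised eigenfunction `e_a` is evaluated on the
sphere of radius `r`. -/
noncomputable def fanPoint (d : ℕ) (r : ℝ) (a : EuclideanSpace ℝ (Fin 2)) : ℝ × ℝ :=
  (|a 0| * r ^ 2 / 2, (a 1 - (d + 1) * |a 0|) * r ^ 2 / 4)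

theorem fanPoint_mem_rayRegion {d : ℕ} (r : ℝ) {a : EuclideanSpace ℝ (Fin 2)}
    (ha : a ∈ heisenbergFan (d + 1)) : fanPoint d r a ∈ rayRegion := by
  rcases ha with ha | ⟨h0, h1⟩
  · obtain ⟨k, hk⟩ := Set.mem_iUnion.1 ha
    have hk : a 1 = (2 * k + (d + 1 : ℕ)) * |a 0| := hk
    have h : (fanPoint d r a).2 = k * (fanPoint d r a).1 := by
      simp only [fanPoint, hk]
      push_cast
      ring
    have h0 : 0 ≤ (fanPoint d r a).1 := by simp only [fanPoint]; positivity
    exact ⟨h0, h ▸ by positivity, Or.inr ⟨k, h⟩⟩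
  · refine ⟨?_, ?_, Or.inl ?_⟩ <;> simp only [fanPoint, h0]
    · simp
    · simp only [abs_zero, mul_zero, sub_zero]; positivity
    · simp

theorem abs_apply_zero_le {n : ℕ} (hn : 1 ≤ n) {a : EuclideanSpace ℝ (Fin 2)}
    (ha : a ∈ heisenbergFan n) : |a 0| ≤ a 1 := by
  rcases ha with ha | ⟨h0, h1⟩
  · obtain ⟨k, hk⟩ := Set.mem_iUnion.1 ha
    have hk : a 1 = (2 * k + n) * |a 0| := hk
    rw [hk]
    have hn : (1 : ℝ) ≤ n := by exact_mod_cast hn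
    have hk0 : (0 : ℝ) ≤ k := Nat.cast_nonneg k
    exact le_mul_of_one_le_left (abs_nonneg _) (by linarith)
  · simpa [h0] using h1

theorem norm_le_two_mul {n : ℕ} (hn : 1 ≤ n) {a : EuclideanSpace ℝ (Fin 2)}
    (ha : a ∈ heisenbergFan n) : ‖a‖ ≤ 2 * a 1 := by
  have h := abs_apply_zero_le hn ha
  have h0 : 0 ≤ a 1 := (abs_nonneg _).trans h
  refine abs_le_of_sq_le_sq' ?_ (by linarith) |>.2
  rw [EuclideanSpace.real_norm_sq_eq, Fin.sum_univ_two]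
  have h1 : a 0 ^ 2 ≤ a 1 ^ 2 := by
    rw [← sq_abs]
    gcongr
  nlinarith

/-- Off `λ = 0`, the continuous function `(τ/|λ| - n)/2` takes values in the closed set `ℕ` on the
fan, hence also at limit points. A limit point with `λ = 0` has `τ ≥ 0`, so it lies on the limiting
ray. -/
theorem isClosed_heisenbergFan {n : ℕ} (hn : 1 ≤ n) : IsClosed (heisenbergFan n) := by
  refine isClosed_of_closure_subset fun a ha => ?_
  have h01 : |a 0| ≤ a 1 := by
    have hcl : IsClosed {a : EuclideanSpace ℝ (Fin 2) | |a 0| ≤ a 1} :=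
      isClosed_le (by fun_prop) (by fun_prop)
    exact hcl.closure_subset_iff.2 (fun b hb => abs_apply_zero_le hn hb) ha
  by_cases h0 : a 0 = 0
  · exact Or.inr ⟨h0, (abs_nonneg _).trans h01⟩
  · have hcont : ContinuousAt (fun b : EuclideanSpace ℝ (Fin 2) => (b 1 / |b 0| - n) / 2) a := by
      refine ContinuousAt.div_const (ContinuousAt.sub ?_ continuousAt_const) 2
      exact ContinuousAt.div (by fun_prop) (by fun_prop) (abs_ne_zero.2 h0)
    have hfreq : ∃ᶠ b : EuclideanSpace ℝ (Fin 2) in 𝓝 a,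
        ((b 1 / |b 0| - n) / 2 : ℝ) ∈ Set.range (Nat.cast : ℕ → ℝ) := by
      have hne : ∀ᶠ b : EuclideanSpace ℝ (Fin 2) in 𝓝 a, b 0 ≠ 0 :=
        ContinuousAt.eventually_ne (g := fun b : EuclideanSpace ℝ (Fin 2) => b 0)
          (by fun_prop) h0
      refine ((mem_closure_iff_frequently.1 ha).and_eventually hne).mono ?_
      rintro b ⟨hb | hb, hb0⟩
      · obtain ⟨k, hk⟩ := Set.mem_iUnion.1 hb
        have hk : b 1 = (2 * k + n) * |b 0| := hk
        refine ⟨k, ?_⟩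
        rw [hk, mul_div_cancel_right₀ _ (abs_ne_zero.2 hb0)]
        ring
      · exact absurd hb.1 hb0
    have hmem : ((a 1 / |a 0| - n) / 2 : ℝ) ∈ Set.range (Nat.cast : ℕ → ℝ) :=
      (Nat.isClosedEmbedding_coe_real.isClosed_range).mem_of_frequently_of_tendsto hfreq hcont
    obtain ⟨k, hk⟩ := hmem
    refine Or.inl (Set.mem_iUnion.2 ⟨k, ?_⟩)
    have h1 : |a 0| ≠ 0 := abs_ne_zero.2 h0
    change a 1 = (2 * k + n) * |a 0|
    rw [hk]
    field_simp
    ring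

/-- The factor normalising the Strichartz Fourier transform at `a`. -/
noncomputable def fanNormConst (n : ℕ) (a : EuclideanSpace ℝ (Fin 2)) : ℂ :=
  if a 0 = 0 then 1
  else ((((fanIndex n a)! * (n - 1)! : ℝ) / ((fanIndex n a + n - 1)! : ℝ) : ℝ) : ℂ)

theorem fanNormConst_ne_zero (n : ℕ) (a : EuclideanSpace ℝ (Fin 2)) : fanNormConst n a ≠ 0 := by
  rw [fanNormConst]
  split_ifs
  · exact one_ne_zero
  · exact Complex.ofReal_ne_zero.2 (by positivity)

theorem fanNormConst_mul_fanEigen {d : ℕ} {a : EuclideanSpace ℝ (Fin 2)}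
    (ha : a ∈ heisenbergFan (d + 1)) (h : Heisenberg (d + 1)) :
    fanNormConst (d + 1) a * fanEigen (d + 1) a h =
      Complex.exp (Complex.I * a 0 * h.2) * fanKernel d (fanPoint d ‖h.1‖ a) := by
  by_cases h0 : a 0 = 0
  · have h1 : 0 ≤ a 1 := (abs_nonneg _).trans (abs_apply_zero_le (Nat.le_add_left 1 d) ha)
    have h2 : fanPoint d ‖h.1‖ a = (0, (√(a 1) * ‖h.1‖) ^ 2 / 4) := by
      simp [fanPoint, h0, mul_pow, Real.sq_sqrt h1]
    rw [fanNormConst, if_pos h0, fanEigen, if_pos h0, h2, fanKernel_zero_left, besselEigen]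
    simp [h0]
  · obtain ⟨k, hk⟩ : ∃ k, a ∈ fanRay (d + 1) k := by
      rcases ha with ha | ha
      · exact Set.mem_iUnion.1 ha
      · exact absurd ha.1 h0
    have hk' : a 1 = (2 * k + (d + 1 : ℕ)) * |a 0| := hk
    have h2 : fanPoint d ‖h.1‖ a =
        (1 / 2 * |a 0| * ‖h.1‖ ^ 2, k * (1 / 2 * |a 0| * ‖h.1‖ ^ 2)) := by
      rw [fanPoint, hk']
      refine Prod.ext ?_ ?_
      · dsimp only
        ring
      · push_cast
        ring
    rw [fanNormConst, if_neg h0, fanEigen, if_neg h0, fanIndex_eq hk h0, h2, fanKernel_nat_mul,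
      normLaguerreFun, ← mul_laguerreL_eq, laguerreEigen, laguerreFun,
      show -(1 / 4) * |a 0| * ‖h.1‖ ^ 2 = -(1 / 2 * |a 0| * ‖h.1‖ ^ 2 / 2) by ring]
    simp only [Nat.add_sub_cancel, ← Nat.add_assoc]
    push_cast
    ring

theorem norm_fanNormConst_mul_fanEigen {d : ℕ} {a : EuclideanSpace ℝ (Fin 2)}
    (ha : a ∈ heisenbergFan (d + 1)) (h : Heisenberg (d + 1)) :
    ‖fanNormConst (d + 1) a * fanEigen (d + 1) a h‖ = |fanKernel d (fanPoint d ‖h.1‖ a)| := by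
  rw [fanNormConst_mul_fanEigen ha, norm_mul, Complex.norm_exp, Complex.norm_real,
    Real.norm_eq_abs]
  simp

theorem norm_fanNormConst_mul_fanEigen_le {d : ℕ} {a : EuclideanSpace ℝ (Fin 2)}
    (ha : a ∈ heisenbergFan (d + 1)) (h : Heisenberg (d + 1)) :
    ‖fanNormConst (d + 1) a * fanEigen (d + 1) a h‖ ≤ √(3 * (2 * d + 9)) := by
  rw [norm_fanNormConst_mul_fanEigen ha]
  exact abs_fanKernel_le d (fanPoint_mem_rayRegion _ ha)

theorem continuous_fanNormConst_mul_fanEigen {d : ℕ} (h : Heisenberg (d + 1)) :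
    Continuous fun a : heisenbergFan (d + 1) =>
      fanNormConst (d + 1) a * fanEigen (d + 1) a h := by
  simp only [fun a : heisenbergFan (d + 1) => fanNormConst_mul_fanEigen a.2 h]
  refine Continuous.mul (by fun_prop) (Complex.continuous_ofReal.comp ?_)
  refine (continuousOn_fanKernel d).comp_continuous ?_ fun a => fanPoint_mem_rayRegion _ a.2
  simp only [fanPoint]
  fun_prop

theorem tendsto_fanNormConst_mul_fanEigen {d : ℕ} {h : Heisenberg (d + 1)} (h0 : h.1 ≠ 0) :
    Tendsto (fun a : heisenbergFan (d + 1) => fanNormConst (d + 1) a * fanEigen (d + 1) a h)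
      (comap (fun a : heisenbergFan (d + 1) => ‖(a : EuclideanSpace ℝ (Fin 2))‖) atTop)
      (𝓝 0) := by
  rw [Metric.tendsto_nhds]
  intro ε hε
  obtain ⟨M, hM⟩ := exists_abs_fanKernel_le d (half_pos hε)
  have hr : 0 < ‖h.1‖ ^ 2 := by
    have := norm_pos_iff.2 h0
    positivity
  -- At `fanPoint`, `2y + (d + 1)x = τ r²/2` with `r = ‖h.1‖`, and `‖a‖ ≤ 2τ` on the fan; hence the
  -- factor `4`.
  filter_upwards [preimage_mem_comap (eventually_ge_atTop (4 * M / ‖h.1‖ ^ 2))] with a ha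
  have ha : 4 * M / ‖h.1‖ ^ 2 ≤ ‖(a : EuclideanSpace ℝ (Fin 2))‖ := ha
  rw [dist_zero_right, norm_fanNormConst_mul_fanEigen a.2]
  refine (hM _ (fanPoint_mem_rayRegion _ a.2) ?_).trans_lt (half_lt_self hε)
  rw [div_le_iff₀ hr] at ha
  have h1 := mul_le_mul_of_nonneg_right (norm_le_two_mul (Nat.le_add_left 1 d) a.2) hr.le
  simp only [fanPoint]
  linarith

/-! ### Integration over the Heisenberg group -/

theorem aestronglyMeasurable_fanNormConst_mul_fanEigen {d : ℕ} {a : EuclideanSpace ℝ (Fin 2)}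
    (ha : a ∈ heisenbergFan (d + 1)) (z : EuclideanSpace ℂ (Fin (d + 1))) :
    AEStronglyMeasurable (fun g : Heisenberg (d + 1) =>
      fanNormConst (d + 1) a * fanEigen (d + 1) a (g⁻¹ * Heisenberg.mk z 0)) volume := by
  simp only [fanNormConst_mul_fanEigen ha]
  have h : Continuous fun g : EuclideanSpace ℂ (Fin (d + 1)) × ℝ =>
      Complex.exp (Complex.I * a 0 * ((-g.2 + 0 + (1 / 2) * imDot (-g.1) z : ℝ) : ℂ)) *
        (fanKernel d (fanPoint d ‖-g.1 + z‖ a) : ℂ) := by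
    refine Continuous.mul ?_ (Complex.continuous_ofReal.comp ?_)
    · simp only [imDot, PiLp.neg_apply]
      fun_prop
    · refine (continuousOn_fanKernel d).comp_continuous ?_ fun g => fanPoint_mem_rayRegion _ ha
      simp only [fanPoint]
      fun_prop
  exact h.aestronglyMeasurable (μ := (volume : Measure (EuclideanSpace ℂ (Fin (d + 1)) × ℝ)))

/-- Over the origin of `ℂⁿ` the normalised eigenfunctions have modulus `1` and do not decay. This
exceptional set is null because the dimension is positive. -/
theorem ae_fst_inv_mul_mk_ne_zero {d : ℕ} (z : EuclideanSpace ℂ (Fin (d + 1))) :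
    ∀ᵐ g : Heisenberg (d + 1), (g⁻¹ * Heisenberg.mk z 0).1 ≠ 0 := by
  have h1 : ∀ᵐ w : EuclideanSpace ℂ (Fin (d + 1)), w ≠ z := by
    have := Measure.IsAddHaarMeasure.nullSingletonClass
      (volume : Measure (EuclideanSpace ℂ (Fin (d + 1))))
    exact Measure.ae_ne volume z
  have h2 : ∀ᵐ g : EuclideanSpace ℂ (Fin (d + 1)) × ℝ, g.1 ≠ z :=
    Measure.quasiMeasurePreserving_fst.ae h1
  have h3 : ∀ᵐ g : EuclideanSpace ℂ (Fin (d + 1)) × ℝ, -g.1 + z ≠ 0 := by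
    filter_upwards [h2] with g hg hg'
    exact hg (neg_add_eq_zero.1 hg')
  exact h3

theorem normStrichartz_eq {n : ℕ} (f : Heisenberg n → ℂ) (a : EuclideanSpace ℝ (Fin 2))
    (z : EuclideanSpace ℂ (Fin n)) : normStrichartz f a z =
      ∫ g : Heisenberg n, f g * (fanNormConst n a * fanEigen n a (g⁻¹ * Heisenberg.mk z 0)) := by
  have h : normStrichartz f a z = fanNormConst n a * strichartz f a z := by
    rw [normStrichartz, fanNormConst]
    split_ifs
    · rw [one_mul]
    · rfl
  rw [h, strichartz, ← integral_const_mul]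
  simp only [mul_left_comm]

theorem theorem1p1 (n : ℕ) (hn : 1 ≤ n) (f : Heisenberg n → ℂ) (hf : Integrable f volume)
    (z : EuclideanSpace ℂ (Fin n)) :
    (∀ a ∈ heisenbergFan n,
      Integrable (fun g : Heisenberg n => f g * fanEigen n a (g⁻¹ * Heisenberg.mk z 0))
        volume) ∧
    UniformContinuous (fun a : heisenbergFan n => normStrichartz f a z) ∧
    Tendsto (fun a : heisenbergFan n => normStrichartz f a z)
      (comap (fun a : heisenbergFan n => ‖(a : EuclideanSpace ℝ (Fin 2))‖) atTop) (𝓝 0) := by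
  obtain ⟨d, rfl⟩ := Nat.exists_eq_add_of_le' hn
  have hmeas : ∀ a : heisenbergFan (d + 1), AEStronglyMeasurable (fun g : Heisenberg (d + 1) =>
      f g * (fanNormConst (d + 1) a * fanEigen (d + 1) a (g⁻¹ * Heisenberg.mk z 0))) volume :=
    fun a => hf.1.mul (aestronglyMeasurable_fanNormConst_mul_fanEigen a.2 z)
  have hbound : ∀ a : heisenbergFan (d + 1), ∀ᵐ g : Heisenberg (d + 1),
      ‖f g * (fanNormConst (d + 1) a * fanEigen (d + 1) a (g⁻¹ * Heisenberg.mk z 0))‖ ≤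
        ‖f g‖ * √(3 * (2 * d + 9)) := fun a => by
    refine Eventually.of_forall fun g => ?_
    rw [norm_mul]
    gcongr
    exact norm_fanNormConst_mul_fanEigen_le a.2 _
  have hint := hf.norm.mul_const √(3 * (2 * d + 9))
  have hlim : Tendsto (fun a : heisenbergFan (d + 1) => normStrichartz f a z)
      (comap (fun a : heisenbergFan (d + 1) => ‖(a : EuclideanSpace ℝ (Fin 2))‖) atTop)
      (𝓝 0) := by
    simp only [normStrichartz_eq]
    rw [← integral_zero (Heisenberg (d + 1)) ℂ]
    refine tendsto_integral_filter_of_dominated_convergence _ (Eventually.of_forall hmeas)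
      (Eventually.of_forall hbound) hint ?_
    filter_upwards [ae_fst_inv_mul_mk_ne_zero z] with g hg
    simpa using (tendsto_fanNormConst_mul_fanEigen hg).const_mul (f g)
  have hcont : Continuous fun a : heisenbergFan (d + 1) => normStrichartz f a z := by
    simp only [normStrichartz_eq]
    exact continuous_of_dominated hmeas hbound hint (Eventually.of_forall fun g =>
      continuous_const.mul (continuous_fanNormConst_mul_fanEigen _))
  refine ⟨fun a ha => ?_, hcont.uniformContinuous_of_tendsto_cocompact (x := 0) ?_, hlim⟩
  -- The uniform bound concerns the normalised integrand; dividing by the nonzero factor, for fixed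
  -- `a`, gives integrability of the original one.
  · have h := (hint.mono' (hmeas ⟨a, ha⟩) (hbound ⟨a, ha⟩)).const_mul (fanNormConst (d + 1) a)⁻¹
    refine h.congr (Eventually.of_forall fun g => ?_)
    have h0 := fanNormConst_ne_zero (d + 1) a
    simp only
    field_simp
  -- Leaving compact subsets of the fan forces `‖a‖ → ∞`, because the fan is closed in a proper
  -- space.
  · refine hlim.mono_left (tendsto_iff_comap.1 ?_)
    exact (tendsto_norm_cocompact_atTop (E := EuclideanSpace ℝ (Fin 2))).comp
      (isClosed_heisenbergFan hn).isClosedEmbedding_subtypeVal.tendsto_cocompact
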